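/- For a class $\mathcal H\subseteq[0,1]^{\mathcal X}$ and $\gamma>0$, a finite set $S\subseteq\mathcal X$ is $V_\gamma$-shattered by $\mathcal H$ if there is a single level $\tau\in[0,1]$ such that for every $A\subseteq S$ some $f_A\in\mathcal H$ satisfies $f_A(x)\ge\tau+\gamma$ for all $x\in A$ and $f_A(x)\le\tau-\gamma$ for all $x\in S\setminus A$. Let $V_{\mathcal H}(\gamma)$ be the largest cardinality of a $V_\gamma$-shattered set. A predictor is a map $\widehat f$ that takes a test point $x\in\mathcal X$ and a training sample $S\in\bigcup_n(\mathcal X\times[0,1])^n$ and outputs $\widehat f(x;S)\in[0,1]$. A distribution $P$ on $\mathcal X\times[0,1]$ is realizable by $\mathcal H$ if there is $f^*\in\mathcal H$ with $Y=f^*(X)$ almost surely for $(X,Y)\sim P$. **Theorem.** There is an absolute constant $C>0$ such that the following holds. Let $\mathcal X$ be a measurable space, let $\mathcal H\subseteq[0,1]^{\mathcal X}$ be a measurable class (for all $n$ and all closed intervals $I_1,\dots,I_n$, the set of $(x_1,\dots,x_n)\in\mathcal X^n$ for which some $f\in\mathcal H$ has $f(x_i)\in I_i$ for all $i$ is universally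 measurable), and let $\gamma\in(0,1)$ be such that $V_{\mathcal H}(\gamma)<\infty$. Then there is a predictor $\widehat f$, universally measurable jointly in the test point and the sample for each sample size, such that for every distribution $P$ realizable by $\mathcal H$, every $\delta\in(0,1)$ and every $n\ge1$, with probability at least $1-\delta$ over a sample $S\sim P^n$, $$\mathbb E_{(X,Y)\sim P}\bigl|\widehat f(X;S)-Y\bigr|\;\le\; C\left(\gamma+\frac{V_{\mathcal H}(\gamma)}{n}+\frac1n\log\frac{2e}{\delta}\right).$$ -/

import Mathlib

open MeasureTheory

/-- A finite set `S ⊆ X` is `V_γ`-shattered by a class `H ⊆ [0,1]^X` if there is a *single* level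
`τ ∈ [0,1]` such that every `A ⊆ S` is cut out by some `f ∈ H` at level `τ` with margin `γ`:
`f ≥ τ + γ` on `A` and `f ≤ τ - γ` on `S \ A`. -/
def VShatters {X : Type*} (H : Set (X → unitInterval)) (γ : ℝ) (S : Finset X) : Prop :=
  ∃ τ : ℝ, 0 ≤ τ ∧ τ ≤ 1 ∧ ∀ A : Finset X, A ⊆ S → ∃ f ∈ H,
    (∀ x ∈ A, τ + γ ≤ (f x : ℝ)) ∧ (∀ x ∈ S, x ∉ A → (f x : ℝ) ≤ τ - γ)

/-- The `V_γ`-dimension of `H`: the largest cardinality of a `V_γ`-shattered finite set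
(`⊤` if there are arbitrarily large ones). -/
noncomputable def vDim {X : Type*} (H : Set (X → unitInterval)) (γ : ℝ) : ℕ∞ :=
  ⨆ (S : Finset X) (_ : VShatters H γ S), (S.card : ℕ∞)

/-- A training sample of arbitrary finite size `n`, as an ordered tuple of labelled points. -/
abbrev TrainingSample (X Y : Type*) : Type _ := Σ n : ℕ, (Fin n → X × Y)

/-- A predictor takes a test point and a training sample and outputs a label. -/
abbrev Predictor (X Y : Type*) : Type _ := X → TrainingSample X Y → Y

/-- A set is universally measurable if it is measurable with respect to the completion of every
probability measure. -/
def UniversallyMeasurableSet {α : Type*} [MeasurableSpace α] (s : Set α) : Prop :=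
  ∀ μ : Measure α, IsProbabilityMeasure μ → NullMeasurableSet s μ

/-- A function is universally measurable if it is measurable with respect to the completion of
every probability measure. -/
def UniversallyMeasurable {α β : Type*} [MeasurableSpace α] [MeasurableSpace β] (f : α → β) :
    Prop :=
  ∀ μ : Measure α, IsProbabilityMeasure μ → AEMeasurable f μ

/-- Measurability of a class `H ⊆ [0,1]^X`: for each sample size `n` and each choice of closed
intervals `[a i, b i]`, the set of point tuples `(x_1, …, x_n)` on which some member of `H` takes
values in the prescribed intervals is universally measurable. (For a countable class this just
follows from measurability of its members; it also holds for all classes on a countable discrete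
space, and for classes that are measurably parametrized by a standard Borel space over a standard
Borel `X`.) -/
def IsMeasurableClass {X : Type*} [MeasurableSpace X] (H : Set (X → unitInterval)) : Prop :=
  ∀ (n : ℕ) (a b : Fin n → ℝ),
    UniversallyMeasurableSet
      {x : Fin n → X | ∃ f ∈ H, ∀ i, (f (x i) : ℝ) ∈ Set.Icc (a i) (b i)}

/-- A predictor is measurable if, for each sample size, the prediction is a universally measurable
function of the test point and the sample jointly. -/
def Predictor.IsMeasurable {X Y : Type*} [MeasurableSpace X] [MeasurableSpace Y]
    (f : Predictor X Y) : Prop :=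
  ∀ n : ℕ, UniversallyMeasurable (fun p : X × (Fin n → X × Y) => f p.1 ⟨n, p.2⟩)

/-- A distribution `P` on `X × [0,1]` is realizable by `H` if `Y = f*(X)` almost surely for some
`f* ∈ H`. -/
def IsRealizable {X : Type*} [MeasurableSpace X] (H : Set (X → unitInterval))
    (P : Measure (X × unitInterval)) : Prop :=
  ∃ f ∈ H, ∀ᵐ z ∂P, z.2 = f z.1

/-- The absolute-loss risk `E_{(X,Y) ∼ P} |h(X) - Y|` of a hypothesis `h`. -/
noncomputable def absRisk {X : Type*} [MeasurableSpace X] (P : Measure (X × unitInterval))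
    (h : X → unitInterval) : ℝ :=
  ∫ z, |(h z.1 : ℝ) - (z.2 : ℝ)| ∂P

/-! Thresholding at a level `τ` turns `H` into a partial binary class: values at least `τ + γ` read
as 1, values at most `τ - γ` as 0, anything between is undefined. On the points with clear labels,
the realized patterns have VC dimension at most d = V(γ). Every subfamily of such patterns spans at
most d one-inclusion edges per vertex (Haussler), so Hall's theorem orients the edges with in-degree
at most d. Predicting the endpoint to which an edge does not point then costs at most d
leave-one-out mistakes (`exists_oneInclusion_rule`, `exists_threshold_rule`). Labels within γ of `τ`
may be mispredicted, but on a fine uniform grid of levels only a fraction of order γ is that close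
to a given label. Averaging over the grid gives a real-valued rule with total leave-one-out error at
most 4γm + d (`exists_leaveOneOut_rule`).

By itself this controls risk only in expectation. For high probability, let r_t be the risk of the
rule trained on the first t points and l_t its loss on the next point. Forward in time, exp ∑ (r_t /
2 - l_t) has mean at most 1. Backward in time, given the unordered first t + 1 points and all later
ones, each of the t + 1 is equally likely to come last, so l_t has conditional mean at most c_t = 4γ
+ d / (t + 1), and exp ∑ (l_t - 2 c_t) has mean at most 1. The backward step needs a rule symmetric
in its training points (`exists_symmetric_leaveOneOut_rule`). Averaging the two exponents and
applying Markov's inequality yields ∑ r_t ≤ 4 ∑ c_t + 4 log (1 / δ) (`measure_prefixSum_risk_le`).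

The final predictor averages the prefix rules over t ≥ n / 2, where c_t is of order γ + d / n;
convexity of the absolute loss bounds its risk by the average of the r_t. -/

open Finset in
/-- The edges of the one-inclusion graph of `𝒜`: pairs `(A, i)` with `i ∉ A` and both `A` and
`insert i A` in `𝒜`. -/
def oneInclusionEdges {α : Type*} [DecidableEq α] [Fintype α] (𝒜 : Finset (Finset α)) :
    Finset (Finset α × α) :=
  {e ∈ 𝒜 ×ˢ univ | e.2 ∉ e.1 ∧ insert e.2 e.1 ∈ 𝒜}

/-! ### One-inclusion graphs: edge density, orientation, prediction. -/

section OneInclusion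

variable {α : Type*} [DecidableEq α] [Fintype α]

lemma mem_oneInclusionEdges {𝒜 : Finset (Finset α)} {A : Finset α} {i : α} :
    (A, i) ∈ oneInclusionEdges 𝒜 ↔ A ∈ 𝒜 ∧ i ∉ A ∧ insert i A ∈ 𝒜 := by
  simp [oneInclusionEdges]

/-- Edges in direction `a` correspond to sets lying in both halves of the family; every other edge
lies inside one half. An edge of either half is an edge of the union, and an edge of both halves is
an edge of the intersection. -/
lemma card_oneInclusionEdges_split (𝒜 : Finset (Finset α)) (a : α) :
    (oneInclusionEdges 𝒜).card ≤
      (oneInclusionEdges (𝒜.nonMemberSubfamily a ∪ 𝒜.memberSubfamily a)).card +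
      (oneInclusionEdges (𝒜.nonMemberSubfamily a ∩ 𝒜.memberSubfamily a)).card +
      (𝒜.nonMemberSubfamily a ∩ 𝒜.memberSubfamily a).card := by
  classical
  set V₀ := 𝒜.nonMemberSubfamily a
  set V₁ := 𝒜.memberSubfamily a
  have h1 : (oneInclusionEdges 𝒜).card ≤
      (oneInclusionEdges V₀).card + (oneInclusionEdges V₁).card + (V₀ ∩ V₁).card := by
    have hsub : oneInclusionEdges 𝒜 ⊆ oneInclusionEdges V₀ ∪
        (oneInclusionEdges V₁).image (fun e => (insert a e.1, e.2)) ∪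
        (V₀ ∩ V₁).image (fun A => (A, a)) := by
      rintro ⟨A, i⟩ h
      obtain ⟨hA, hi, hiA⟩ := mem_oneInclusionEdges.1 h
      simp only [Finset.mem_union, Finset.mem_image, Prod.exists, Prod.mk.injEq,
        mem_oneInclusionEdges, Finset.mem_inter]
      by_cases hia : i = a
      · subst hia
        exact Or.inr ⟨A, by simp [V₀, V₁, *], rfl, rfl⟩
      · by_cases haA : a ∈ A
        · refine Or.inl (Or.inr ⟨A.erase a, i, ⟨?_, ?_, ?_⟩, Finset.insert_erase haA, rfl⟩)
          · simp [V₁, Finset.mem_memberSubfamily, Finset.insert_erase haA, hA]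
          · simp [hi]
          · simp only [V₁, Finset.mem_memberSubfamily]
            refine ⟨?_, ?_⟩
            · rwa [Finset.insert_comm, Finset.insert_erase haA]
            · simp [Ne.symm hia]
        · refine Or.inl (Or.inl ⟨?_, hi, ?_⟩)
          · simp [V₀, Finset.mem_nonMemberSubfamily, hA, haA]
          · simp [V₀, Finset.mem_nonMemberSubfamily, hiA, haA, Ne.symm hia]
    refine (Finset.card_le_card hsub).trans ((Finset.card_union_le _ _).trans ?_)
    refine add_le_add ((Finset.card_union_le _ _).trans ?_) Finset.card_image_le
    exact add_le_add le_rfl Finset.card_image_le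
  have h2 : (oneInclusionEdges V₀).card + (oneInclusionEdges V₁).card ≤
      (oneInclusionEdges (V₀ ∪ V₁)).card + (oneInclusionEdges (V₀ ∩ V₁)).card := by
    rw [← Finset.card_union_add_card_inter]
    refine add_le_add (Finset.card_le_card ?_) (Finset.card_le_card ?_)
    · rintro ⟨A, i⟩ h
      simp only [Finset.mem_union, mem_oneInclusionEdges] at h ⊢
      tauto
    · rintro ⟨A, i⟩ h
      simp only [Finset.mem_inter, mem_oneInclusionEdges] at h ⊢
      tauto
  omega

/-- Haussler's edge density bound for one-inclusion graphs, relative to a ground set. -/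
lemma card_oneInclusionEdges_le_of_subset (U : Finset α) : ∀ (d : ℕ) (𝒜 : Finset (Finset α)),
    (∀ A ∈ 𝒜, A ⊆ U) → (∀ s, 𝒜.Shatters s → s.card ≤ d) →
    (oneInclusionEdges 𝒜).card ≤ d * 𝒜.card := by
  classical
  induction U using Finset.induction_on with
  | empty =>
    intro d 𝒜 hU _
    have : oneInclusionEdges 𝒜 = ∅ := by
      refine Finset.eq_empty_of_forall_notMem ?_
      rintro ⟨A, i⟩ h
      have := hU _ (mem_oneInclusionEdges.1 h).2.2 (Finset.mem_insert_self i A)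
      simp at this
    simp [this]
  | insert a U ha ih =>
    intro d 𝒜 hU hd
    have hsplit := card_oneInclusionEdges_split 𝒜 a
    set V₀ := 𝒜.nonMemberSubfamily a with hV₀
    set V₁ := 𝒜.memberSubfamily a with hV₁
    have hcard : V₀.card + V₁.card = 𝒜.card := by
      rw [add_comm]; exact Finset.card_memberSubfamily_add_card_nonMemberSubfamily a 𝒜
    have hcard' : (V₀ ∪ V₁).card + (V₀ ∩ V₁).card = 𝒜.card := by
      rw [Finset.card_union_add_card_inter, hcard]
    have hV₀U : ∀ A ∈ V₀, A ⊆ U := by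
      intro A hA
      rw [hV₀, Finset.mem_nonMemberSubfamily] at hA
      exact (Finset.subset_insert_iff_of_notMem hA.2).1 (hU A hA.1)
    have hV₁U : ∀ A ∈ V₁, A ⊆ U := by
      intro A hA
      rw [hV₁, Finset.mem_memberSubfamily] at hA
      exact (Finset.subset_insert_iff_of_notMem hA.2).1
        ((Finset.subset_insert a A).trans (hU _ hA.1))
    have hlift : ∀ A ∈ V₀ ∪ V₁, A ∈ 𝒜 ∨ insert a A ∈ 𝒜 := by
      intro A hA
      rcases Finset.mem_union.1 hA with h | h
      · exact Or.inl (Finset.mem_nonMemberSubfamily.1 h).1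
      · exact Or.inr (Finset.mem_memberSubfamily.1 h).1
    have hnot : ∀ s, (V₀ ∪ V₁).Shatters s → a ∉ s := by
      intro s hs has
      obtain ⟨u, hu, hus⟩ := hs (Finset.Subset.refl s)
      have hau : a ∈ u := (Finset.mem_inter.1 (hus.symm ▸ has)).2
      rcases Finset.mem_union.1 hu with h | h
      · exact ha (hV₀U _ h hau)
      · exact ha (hV₁U _ h hau)
    have hunion : (oneInclusionEdges (V₀ ∪ V₁)).card ≤ d * (V₀ ∪ V₁).card := by
      refine ih d _ (fun A hA => (Finset.mem_union.1 hA).elim (hV₀U A) (hV₁U A)) ?_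
      intro s hs
      refine hd s ?_
      intro t ht
      obtain ⟨u, hu, hut⟩ := hs ht
      rcases hlift u hu with h | h
      · exact ⟨u, h, hut⟩
      · exact ⟨_, h, by rw [Finset.inter_insert_of_notMem (hnot s hs), hut]⟩
    -- Sets in the intersection extend to `𝒜` both with and without `a`, so a shattered `s` enlarges
    -- to the shattered set `insert a s`. The dimension drop by one pays for the edges in direction
    -- `a`.
    have hinter : ∀ s, (V₀ ∩ V₁).Shatters s → s.card + 1 ≤ d := by
      intro s hs
      have has : a ∉ s := hnot s (hs.mono_left
        (Finset.inter_subset_left.trans Finset.subset_union_left))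
      rw [← Finset.card_insert_of_notMem has]
      refine hd _ ?_
      intro t ht
      have hte : t.erase a ⊆ s := by
        intro x hx
        exact (Finset.mem_insert.1 (ht (Finset.mem_of_mem_erase hx))).resolve_left
          (Finset.ne_of_mem_erase hx)
      obtain ⟨u, hu, hut⟩ := hs hte
      obtain ⟨hu0, hu1⟩ := Finset.mem_inter.1 hu
      rw [hV₀, Finset.mem_nonMemberSubfamily] at hu0
      rw [hV₁, Finset.mem_memberSubfamily] at hu1
      by_cases hat : a ∈ t
      · refine ⟨_, hu1.1, ?_⟩
        rw [← Finset.insert_inter_distrib, hut, Finset.insert_erase hat]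
      · refine ⟨u, hu0.1, ?_⟩
        rw [Finset.insert_inter_of_notMem hu0.2, hut, Finset.erase_eq_of_notMem hat]
    rcases (V₀ ∩ V₁).eq_empty_or_nonempty with hem | hne
    · have h0 : (oneInclusionEdges (V₀ ∩ V₁)).card = 0 := by
        rw [hem]; simp [oneInclusionEdges]
      rw [hem] at hcard'
      rw [h0, hem] at hsplit
      simp only [Finset.card_empty, add_zero] at hsplit hcard'
      rw [← hcard']
      exact hsplit.trans hunion
    · obtain ⟨k, rfl⟩ : ∃ k, d = k + 1 := by
        have := hinter ∅ (by
          obtain ⟨u, hu⟩ := hne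
          intro t ht
          exact ⟨u, hu, by simp [Finset.subset_empty.1 ht]⟩)
        exact ⟨d - 1, by simp at this; omega⟩
      have hint := ih k (V₀ ∩ V₁) (fun A hA => hV₀U A (Finset.mem_inter.1 hA).1)
        (fun s hs => by have := hinter s hs; omega)
      rw [← hcard']
      nlinarith

/-- Haussler's edge density bound for one-inclusion graphs. -/
lemma card_oneInclusionEdges_le {d : ℕ} {𝒜 : Finset (Finset α)}
    (hd : ∀ s, 𝒜.Shatters s → s.card ≤ d) : (oneInclusionEdges 𝒜).card ≤ d * 𝒜.card :=
  card_oneInclusionEdges_le_of_subset Finset.univ d 𝒜 (fun _ _ => Finset.subset_univ _) hd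

/-- Orientation of the one-inclusion graph: each edge selects one of its endpoints so that no
vertex is selected more than `d` times. -/
lemma exists_oneInclusion_orientation {d : ℕ} {𝒜 : Finset (Finset α)}
    (hd : ∀ s, 𝒜.Shatters s → s.card ≤ d) :
    ∃ o : oneInclusionEdges 𝒜 → Finset α × Fin d, Function.Injective o ∧
      ∀ e, (o e).1 = e.1.1 ∨ (o e).1 = insert e.1.2 e.1.1 := by
  classical
  let r : oneInclusionEdges 𝒜 → Finset (Finset α × Fin d) := fun e =>
    ({e.1.1, insert e.1.2 e.1.1} : Finset (Finset α)) ×ˢ Finset.univ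
  -- Hall's condition, with `d` copies of each vertex: it is the density bound for the subfamily `V`
  -- of endpoints of `E`, which shatters no more than `𝒜` does.
  have hall : ∀ E : Finset (oneInclusionEdges 𝒜), E.card ≤ (E.biUnion r).card := by
    intro E
    let V : Finset (Finset α) := E.biUnion fun e => {e.1.1, insert e.1.2 e.1.1}
    have hV : E.biUnion r = V ×ˢ Finset.univ := by
      ext ⟨A, j⟩
      simp [r, V]
    have hV𝒜 : V ⊆ 𝒜 := by
      intro A hA
      obtain ⟨e, _, heA⟩ := Finset.mem_biUnion.1 hA
      have he := mem_oneInclusionEdges.1 e.2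
      rcases Finset.mem_insert.1 heA with h | h
      · exact h ▸ he.1
      · exact (Finset.mem_singleton.1 h) ▸ he.2.2
    have hE : E.map ⟨Subtype.val, Subtype.val_injective⟩ ⊆ oneInclusionEdges V := by
      intro e he
      obtain ⟨e', he', rfl⟩ := Finset.mem_map.1 he
      refine mem_oneInclusionEdges.2 ⟨?_, (mem_oneInclusionEdges.1 e'.2).2.1, ?_⟩
      · exact Finset.mem_biUnion.2 ⟨e', he', by simp⟩
      · exact Finset.mem_biUnion.2 ⟨e', he', by simp⟩
    have hdV : ∀ s, V.Shatters s → s.card ≤ d := fun s hs => hd s (hs.mono_left hV𝒜)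
    have := (Finset.card_le_card hE).trans (card_oneInclusionEdges_le hdV)
    rw [Finset.card_map] at this
    rw [hV, Finset.card_product, Finset.card_univ, Fintype.card_fin, mul_comm]
    exact this
  obtain ⟨o, ho, hor⟩ := (Finset.all_card_le_biUnion_card_iff_exists_injective r).1 hall
  refine ⟨o, ho, fun e => ?_⟩
  have := hor e
  simpa [r] using this

/-- The one-inclusion prediction rule makes at most `d` leave-one-out mistakes on every pattern of
a family of VC dimension at most `d`. -/
lemma exists_oneInclusion_rule {d : ℕ} {𝒜 : Finset (Finset α)}
    (hd : ∀ s, 𝒜.Shatters s → s.card ≤ d) :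
    ∃ p : α → Finset α → Prop, ∀ A ∈ 𝒜, ∀ s : Finset α,
      (∀ i ∈ s, ¬ (p i (A.erase i) ↔ i ∈ A)) → s.card ≤ d := by
  classical
  obtain ⟨o, ho, hor⟩ := exists_oneInclusion_orientation hd
  -- On an edge, the prediction is the endpoint that was not selected, so a mistake on `A` means
  -- that the edge selected `A`. Off the edges at most one completion of `B` lies in `𝒜`, and no
  -- mistake occurs.
  refine ⟨fun i B => if h : (B, i) ∈ oneInclusionEdges 𝒜 then (o ⟨_, h⟩).1 = B
    else insert i B ∈ 𝒜, fun A hA s hs => ?_⟩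
  have key : ∀ i ∈ s, ∃ h : (A.erase i, i) ∈ oneInclusionEdges 𝒜, (o ⟨_, h⟩).1 = A := by
    intro i hi
    have h1 := hs i hi
    beta_reduce at h1
    by_cases h : (A.erase i, i) ∈ oneInclusionEdges 𝒜
    · refine ⟨h, ?_⟩
      rw [dif_pos h] at h1
      have h2 := hor ⟨_, h⟩
      simp only at h2
      by_cases hiA : i ∈ A
      · rw [Finset.insert_erase hiA] at h2
        tauto
      · have h3 : (o ⟨_, h⟩).1 = A.erase i := by tauto
        exact h3.trans (Finset.erase_eq_of_notMem hiA)
    · exfalso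
      rw [dif_neg h] at h1
      by_cases hiA : i ∈ A
      · rw [Finset.insert_erase hiA] at h1
        tauto
      · rw [mem_oneInclusionEdges] at h
        rw [Finset.erase_eq_of_notMem hiA] at h h1
        tauto
  choose h hh using key
  let g : s → Fin d := fun i => (o ⟨_, h i.1 i.2⟩).2
  have hg : Function.Injective g := by
    intro i j hij
    have h3 : o ⟨_, h i.1 i.2⟩ = o ⟨_, h j.1 j.2⟩ :=
      Prod.ext ((hh i.1 i.2).trans (hh j.1 j.2).symm) hij
    have h4 := congrArg (fun e => e.1.2) (ho h3)
    exact Subtype.ext h4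
  have := Fintype.card_le_of_injective g hg
  simpa using this

end OneInclusion

/-! ### Stability properties of universal measurability. -/

section UniversalMeasurability

variable {α β κ δ : Type*} [MeasurableSpace α] [MeasurableSpace β] [MeasurableSpace δ]

lemma Measurable.universallyMeasurable {f : α → β} (hf : Measurable f) :
    UniversallyMeasurable f := fun _ _ => hf.aemeasurable

lemma UniversallyMeasurable.comp_measurable {f : β → δ} {g : α → β}
    (hf : UniversallyMeasurable f) (hg : Measurable g) :
    UniversallyMeasurable (fun a => f (g a)) := fun μ _ =>
  (hf (μ.map g) (Measure.isProbabilityMeasure_map hg.aemeasurable)).comp_measurable hg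

lemma Measurable.comp_universallyMeasurable {f : β → δ} {g : α → β}
    (hf : Measurable f) (hg : UniversallyMeasurable g) :
    UniversallyMeasurable (fun a => f (g a)) := fun μ hμ =>
  hf.comp_aemeasurable (hg μ hμ)

lemma UniversallyMeasurableSet.preimage {s : Set β} {g : α → β}
    (hs : UniversallyMeasurableSet s) (hg : Measurable g) :
    UniversallyMeasurableSet (g ⁻¹' s) := fun μ _ =>
  (hs (μ.map g) (Measure.isProbabilityMeasure_map hg.aemeasurable)).preimage
    (hg.quasiMeasurePreserving μ)

/-- A real function factoring through a finite-valued map with universally measurable fibres is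
universally measurable. -/
lemma universallyMeasurable_of_finite [Finite κ] {q : α → κ}
    (hq : ∀ k, UniversallyMeasurableSet (q ⁻¹' {k})) (Φ : κ → ℝ) :
    UniversallyMeasurable (fun a => Φ (q a)) := by
  intro μ hμ
  refine NullMeasurable.aemeasurable fun s _ => ?_
  have : (fun a => Φ (q a)) ⁻¹' s = ⋃ k ∈ Φ ⁻¹' s, q ⁻¹' {k} := by
    ext a; simp
  rw [this]
  exact NullMeasurableSet.biUnion (Set.to_countable _) fun k _ => hq k μ hμ

end UniversalMeasurability

/-! ### The one-inclusion rule at a single threshold. -/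

section ThresholdRule

variable {X : Type*} {m : ℕ}

open Classical in
/-- The `0/1`-patterns on the points `x j`, `j ∈ J`, that `H` realizes at level `τ` with margin
`γ`. -/
noncomputable def realizedPatterns (H : Set (X → unitInterval)) (γ τ : ℝ) (J : Finset (Fin m))
    (x : Fin m → X) : Finset (Finset (Fin m)) :=
  {A ∈ J.powerset | ∃ f ∈ H, (∀ i ∈ A, τ + γ ≤ (f (x i) : ℝ)) ∧
    ∀ i ∈ J, i ∉ A → (f (x i) : ℝ) ≤ τ - γ}

lemma mem_realizedPatterns {H : Set (X → unitInterval)} {γ τ : ℝ} {J : Finset (Fin m)}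
    {x : Fin m → X} {A : Finset (Fin m)} :
    A ∈ realizedPatterns H γ τ J x ↔ A ⊆ J ∧ ∃ f ∈ H, (∀ i ∈ A, τ + γ ≤ (f (x i) : ℝ)) ∧
      ∀ i ∈ J, i ∉ A → (f (x i) : ℝ) ≤ τ - γ := by
  simp [realizedPatterns]

/-- Shattered indices carry distinct points, since one value cannot be both at least `τ + γ` and at
most `τ - γ`; their image is therefore `V_γ`-shattered with the same cardinality. -/
lemma card_le_of_shatters_realizedPatterns {H : Set (X → unitInterval)} {γ τ : ℝ} {d : ℕ}
    (hγ : 0 < γ) (h0 : 0 ≤ τ) (h1 : τ ≤ 1) (hd : vDim H γ = d) {J : Finset (Fin m)}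
    {x : Fin m → X} {s : Finset (Fin m)} (hs : (realizedPatterns H γ τ J x).Shatters s) :
    s.card ≤ d := by
  classical
  have hsJ : s ⊆ J := by
    obtain ⟨u, hu, hus⟩ := hs (Finset.Subset.refl s)
    exact (Finset.inter_eq_left.1 hus).trans (mem_realizedPatterns.1 hu).1
  have hcut : ∀ t ⊆ s, ∃ f ∈ H, (∀ i ∈ t, τ + γ ≤ (f (x i) : ℝ)) ∧
      ∀ i ∈ s, i ∉ t → (f (x i) : ℝ) ≤ τ - γ := by
    intro t ht
    obtain ⟨u, hu, hut⟩ := hs ht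
    obtain ⟨_, f, hf, hfu, hfn⟩ := mem_realizedPatterns.1 hu
    refine ⟨f, hf, fun i hi => hfu i ?_, fun i hi hit => hfn i (hsJ hi) fun hiu => hit ?_⟩
    · rw [← hut] at hi
      exact (Finset.mem_inter.1 hi).2
    · rw [← hut]
      exact Finset.mem_inter.2 ⟨hi, hiu⟩
  have hinj : Set.InjOn x s := by
    intro i hi j hj hij
    by_contra hne
    obtain ⟨f, _, hf1, hf2⟩ := hcut {i} (Finset.singleton_subset_iff.2 hi)
    have a := hf1 i (Finset.mem_singleton_self i)
    have b := hf2 j hj (by simpa using Ne.symm hne)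
    rw [hij] at a
    linarith
  have hsh : VShatters H γ (s.image x) := by
    refine ⟨τ, h0, h1, fun A _ => ?_⟩
    obtain ⟨f, hf, hf1, hf2⟩ := hcut (s.filter fun i => x i ∈ A) (Finset.filter_subset _ _)
    refine ⟨f, hf, fun y hy => ?_, fun y hy hyA => ?_⟩
    · obtain ⟨i, hi, rfl⟩ := Finset.mem_image.1 (‹A ⊆ s.image x› hy)
      exact hf1 i (by simp [hi, hy])
    · obtain ⟨i, hi, rfl⟩ := Finset.mem_image.1 hy
      exact hf2 i hi (by simp [hyA])
  have hle : ((s.image x).card : ℕ∞) ≤ vDim H γ :=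
    le_iSup₂ (f := fun (S : Finset X) (_ : VShatters H γ S) => (S.card : ℕ∞)) _ hsh
  rw [hd, Finset.card_image_of_injOn hinj] at hle
  exact_mod_cast hle

lemma universallyMeasurableSet_realizedPatterns [MeasurableSpace X] {H : Set (X → unitInterval)}
    (hH : IsMeasurableClass H) (γ τ : ℝ) (J : Finset (Fin m)) (𝒜 : Finset (Finset (Fin m))) :
    UniversallyMeasurableSet {x : Fin m → X | realizedPatterns H γ τ J x = 𝒜} := by
  classical
  have hA : ∀ A : Finset (Fin m),
      UniversallyMeasurableSet {x : Fin m → X | A ∈ realizedPatterns H γ τ J x} := by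
    intro A
    by_cases hAJ : A ⊆ J
    -- Unconstrained sides of the intervals are filled in by the trivial bounds 0 and 1.
    · convert hH m (fun i => if i ∈ A then τ + γ else 0)
        (fun i => if i ∈ A then 1 else if i ∈ J then τ - γ else 1) using 1
      ext x
      simp only [Set.mem_ofPred_eq, mem_realizedPatterns, hAJ, true_and, Set.mem_Icc]
      refine exists_congr fun f => and_congr_right fun _ => ⟨?_, ?_⟩
      · rintro ⟨h1, h2⟩ i
        have hi0 := (f (x i)).2.1
        have hi1 := (f (x i)).2.2
        by_cases hiA : i ∈ A
        · simp [hiA, h1 i hiA, hi1]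
        · by_cases hiJ : i ∈ J
          · simp [hiA, hiJ, h2 i hiJ hiA, hi0]
          · simp [hiA, hiJ, hi0, hi1]
      · intro h
        refine ⟨fun i hi => ?_, fun i hiJ hiA => ?_⟩
        · have := (h i).1
          rwa [if_pos hi] at this
        · have := (h i).2
          rwa [if_neg hiA, if_pos hiJ] at this
    · intro μ _
      have : {x : Fin m → X | A ∈ realizedPatterns H γ τ J x} = ∅ := by
        ext x; simp [mem_realizedPatterns, hAJ]
      rw [this]
      exact MeasurableSet.empty.nullMeasurableSet
  intro μ hμ
  have : {x : Fin m → X | realizedPatterns H γ τ J x = 𝒜} =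
      ⋂ A, if A ∈ 𝒜 then {x | A ∈ realizedPatterns H γ τ J x}
        else {x | A ∈ realizedPatterns H γ τ J x}ᶜ := by
    ext x
    simp only [Set.mem_ofPred_eq, Set.mem_iInter, Finset.ext_iff]
    refine forall_congr' fun A => ?_
    by_cases h : A ∈ 𝒜 <;> simp [h]
  rw [this]
  refine NullMeasurableSet.iInter fun A => ?_
  split_ifs
  · exact hA A μ hμ
  · exact (hA A μ hμ).compl

open Classical in
/-- The indices whose labels are bounded away from `τ` by at least `γ`. -/
noncomputable def clearIndices (γ τ : ℝ) (z : Fin m → X × unitInterval) : Finset (Fin m) :=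
  {j | τ + γ ≤ ((z j).2 : ℝ) ∨ ((z j).2 : ℝ) ≤ τ - γ}

open Classical in
/-- The indices whose labels are above `τ` by at least `γ`. -/
noncomputable def highIndices (γ τ : ℝ) (z : Fin m → X × unitInterval) : Finset (Fin m) :=
  {j | τ + γ ≤ ((z j).2 : ℝ)}

lemma mem_clearIndices {γ τ : ℝ} {z : Fin m → X × unitInterval} {j : Fin m} :
    j ∈ clearIndices γ τ z ↔ τ + γ ≤ ((z j).2 : ℝ) ∨ ((z j).2 : ℝ) ≤ τ - γ := by
  simp [clearIndices]

lemma mem_highIndices {γ τ : ℝ} {z : Fin m → X × unitInterval} {j : Fin m} :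
    j ∈ highIndices γ τ z ↔ τ + γ ≤ ((z j).2 : ℝ) := by
  simp [highIndices]

open Classical in
/-- The information available for predicting at index `i`: the clear indices together with `i`, the
high indices other than `i`, and the realized patterns. -/
noncomputable def thresholdData (H : Set (X → unitInterval)) (γ τ : ℝ) (i : Fin m)
    (z : Fin m → X × unitInterval) :
    Finset (Fin m) × Finset (Fin m) × Finset (Finset (Fin m)) :=
  (insert i (clearIndices γ τ z), (highIndices γ τ z).erase i,
    realizedPatterns H γ τ (insert i (clearIndices γ τ z)) (fun j => (z j).1))

/-- Forcing `i` into the clear indices and out of the high ones erases all trace of the label at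
`i`. -/
lemma thresholdData_congr (H : Set (X → unitInterval)) (γ τ : ℝ) (i : Fin m)
    {z z' : Fin m → X × unitInterval} (hi : (z i).1 = (z' i).1) (h : ∀ j, j ≠ i → z j = z' j) :
    thresholdData H γ τ i z = thresholdData H γ τ i z' := by
  classical
  have h1 : insert i (clearIndices γ τ z) = insert i (clearIndices γ τ z') := by
    ext j
    by_cases hj : j = i
    · simp [hj]
    · simp [hj, mem_clearIndices, h j hj]
  have h2 : (highIndices γ τ z).erase i = (highIndices γ τ z').erase i := by
    ext j
    by_cases hj : j = i
    · simp [hj]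
    · simp [hj, mem_highIndices, h j hj]
  have h3 : (fun j => (z j).1) = fun j => (z' j).1 := by
    ext j
    by_cases hj : j = i
    · rw [hj, hi]
    · rw [h j hj]
  simp only [thresholdData, h1, h2, h3]

lemma universallyMeasurableSet_thresholdData [MeasurableSpace X] {H : Set (X → unitInterval)}
    (hH : IsMeasurableClass H) (γ τ : ℝ) (i : Fin m)
    (k : Finset (Fin m) × Finset (Fin m) × Finset (Finset (Fin m))) :
    UniversallyMeasurableSet (thresholdData H γ τ i ⁻¹' {k}) := by
  classical
  obtain ⟨J, A, 𝒜⟩ := k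
  have hy : ∀ j, Measurable fun z : Fin m → X × unitInterval => ((z j).2 : ℝ) := fun j => by
    fun_prop
  have hlow : ∀ j, MeasurableSet {z : Fin m → X × unitInterval | j ∈ clearIndices γ τ z} :=
    fun j => by
      simp only [mem_clearIndices]
      exact (measurableSet_le measurable_const (hy j)).union
        (measurableSet_le (hy j) measurable_const)
  have hhigh : ∀ j, MeasurableSet {z : Fin m → X × unitInterval | j ∈ highIndices γ τ z} :=
    fun j => by
      simp only [mem_highIndices]
      exact measurableSet_le measurable_const (hy j)
  have hJ : MeasurableSet {z : Fin m → X × unitInterval |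
      insert i (clearIndices γ τ z) = J} := by
    simp only [Finset.ext_iff, Finset.mem_insert]
    refine measurableSet_setOfPred.2 (Measurable.forall fun j => Measurable.iff ?_ measurable_const)
    exact measurable_const.or (measurableSet_setOfPred.1 (hlow j))
  have hA : MeasurableSet {z : Fin m → X × unitInterval |
      (highIndices γ τ z).erase i = A} := by
    simp only [Finset.ext_iff, Finset.mem_erase]
    refine measurableSet_setOfPred.2 (Measurable.forall fun j => Measurable.iff ?_ measurable_const)
    exact measurable_const.and (measurableSet_setOfPred.1 (hhigh j))
  have hF := (universallyMeasurableSet_realizedPatterns hH γ τ J 𝒜).preimage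
    (g := fun z : Fin m → X × unitInterval => fun j => (z j).1) (by fun_prop)
  intro μ hμ
  have : thresholdData H γ τ i ⁻¹' {(J, A, 𝒜)} =
      {z | insert i (clearIndices γ τ z) = J} ∩
      ({z | (highIndices γ τ z).erase i = A} ∩
      (fun z : Fin m → X × unitInterval => fun j => (z j).1) ⁻¹'
        {x | realizedPatterns H γ τ J x = 𝒜}) := by
    ext z
    simp only [thresholdData, Set.mem_preimage, Set.mem_singleton_iff, Prod.mk.injEq,
      Set.mem_inter_iff, Set.mem_ofPred_eq]
    refine and_congr_right fun h => ?_
    rw [h]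
  rw [this]
  exact hJ.nullMeasurableSet.inter (hA.nullMeasurableSet.inter (hF μ hμ))

open Classical in
/-- The one-inclusion prediction rule for the thresholded class. -/
lemma exists_threshold_rule [MeasurableSpace X] {H : Set (X → unitInterval)}
    (hH : IsMeasurableClass H) {γ τ : ℝ} (hγ : 0 < γ) (h0 : 0 ≤ τ) (h1 : τ ≤ 1) {d : ℕ}
    (hd : vDim H γ = d) (m : ℕ) :
    ∃ h : Fin m → (Fin m → X × unitInterval) → ℝ,
      (∀ i, UniversallyMeasurable (h i)) ∧ (∀ i z, h i z ∈ Set.Icc (0 : ℝ) 1) ∧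
      (∀ i z z', (z i).1 = (z' i).1 → (∀ j, j ≠ i → z j = z' j) → h i z = h i z') ∧
      ∀ f ∈ H, ∀ z : Fin m → X × unitInterval, (∀ i, (z i).2 = f (z i).1) →
        ∑ i, |h i z - if τ ≤ ((z i).2 : ℝ) then 1 else 0| ≤
          d + ∑ i, if |τ - ((z i).2 : ℝ)| < γ then (1 : ℝ) else 0 := by
  -- The rule is chosen once per family, with a dummy value when the dimension is too large, so that
  -- predictions factor through the finite-valued `thresholdData` and measurability follows.
  have hp : ∀ 𝒜 : Finset (Finset (Fin m)), ∃ p : Fin m → Finset (Fin m) → Prop,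
      (∀ s, 𝒜.Shatters s → s.card ≤ d) → ∀ A ∈ 𝒜, ∀ s : Finset (Fin m),
        (∀ i ∈ s, ¬ (p i (A.erase i) ↔ i ∈ A)) → s.card ≤ d := by
    intro 𝒜
    by_cases h : ∀ s, 𝒜.Shatters s → s.card ≤ d
    · obtain ⟨p, hp⟩ := exists_oneInclusion_rule h
      exact ⟨p, fun _ => hp⟩
    · exact ⟨fun _ _ => True, fun h' => absurd h' h⟩
  choose p hp using hp
  let Φ : Fin m → Finset (Fin m) × Finset (Fin m) × Finset (Finset (Fin m)) → ℝ :=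
    fun i k => if p k.2.2 i k.2.1 then 1 else 0
  refine ⟨fun i z => Φ i (thresholdData H γ τ i z), fun i => ?_, fun i z => ?_,
    fun i z z' hi hj => ?_, fun f hf z hz => ?_⟩
  · exact universallyMeasurable_of_finite (universallyMeasurableSet_thresholdData hH γ τ i) (Φ i)
  · simp only [Φ]
    split_ifs <;> simp
  · simp only [thresholdData_congr H γ τ i hi hj]
  · set J := (clearIndices γ τ z) with hJ
    set A := (highIndices γ τ z) with hA
    set 𝒜 := realizedPatterns H γ τ J (fun j => (z j).1) with h𝒜
    have hA𝒜 : A ∈ 𝒜 := by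
      refine mem_realizedPatterns.2 ⟨fun j hj => ?_, f, hf, fun j hj => ?_, fun j hj hjA => ?_⟩
      · exact mem_clearIndices.2 (Or.inl (mem_highIndices.1 hj))
      · rw [← hz]
        exact mem_highIndices.1 hj
      · rw [← hz]
        exact (mem_clearIndices.1 hj).resolve_left fun h => hjA (mem_highIndices.2 h)
    have hmist := hp 𝒜
      (fun s hs => card_le_of_shatters_realizedPatterns hγ h0 h1 hd hs) A hA𝒜
      {i | i ∈ J ∧ ¬ (p 𝒜 i (A.erase i) ↔ i ∈ A)} (by simp)
    have hterm : ∀ i, |Φ i (thresholdData H γ τ i z) - if τ ≤ ((z i).2 : ℝ) then 1 else 0| ≤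
        (if i ∈ J ∧ ¬ (p 𝒜 i (A.erase i) ↔ i ∈ A) then 1 else 0) +
          if |τ - ((z i).2 : ℝ)| < γ then (1 : ℝ) else 0 := by
      intro i
      by_cases hi : |τ - ((z i).2 : ℝ)| < γ
      · rw [if_pos hi]
        have : |Φ i (thresholdData H γ τ i z) - if τ ≤ ((z i).2 : ℝ) then 1 else 0| ≤ 1 := by
          simp only [Φ]
          split_ifs <;> simp
        have h2 : (0 : ℝ) ≤ if i ∈ J ∧ ¬ (p 𝒜 i (A.erase i) ↔ i ∈ A) then 1 else 0 := by
          split_ifs <;> simp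
        linarith
      · have hiJ : i ∈ J := by
          refine mem_clearIndices.2 ?_
          rw [not_lt, le_abs] at hi
          rcases hi with h | h
          · right; linarith
          · left; linarith
        -- All clear indices thus consult the same family `𝒜`, which is what lets the mistake bound
        -- for one family cover them together.
        have hins : insert i J = J := Finset.insert_eq_self.2 hiJ
        have hiA : i ∈ A ↔ τ ≤ ((z i).2 : ℝ) := by
          have hiJ' := mem_clearIndices.1 hiJ
          rw [hA, mem_highIndices]
          constructor
          · intro h; linarith
          · intro h
            refine hiJ'.resolve_right fun h' => ?_
            linarith
        have hT : thresholdData H γ τ i z = (J, A.erase i, 𝒜) := by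
          simp only [thresholdData, ← hJ, ← hA, hins, h𝒜]
        simp only [hT, Φ, ← hiA, hiJ, true_and, hi, if_false, add_zero]
        by_cases a : p 𝒜 i (A.erase i) <;> by_cases b : i ∈ A <;>
          simp only [a, b] <;> norm_num
    refine (Finset.sum_le_sum fun i _ => hterm i).trans ?_
    rw [Finset.sum_add_distrib, Finset.sum_boole]
    gcongr

end ThresholdRule

/-! ### From thresholds to real values by averaging over a grid of levels. -/

section RealRule

variable {X : Type*} {m : ℕ}

lemma sum_grid_le_eq {N : ℕ} (hN : 0 < N) {y : ℝ} (h0 : 0 ≤ y) (h1 : y ≤ 1) :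
    ∑ k ∈ Finset.Icc 1 N, (if (k : ℝ) / N ≤ y then (1 : ℝ) else 0) = ⌊N * y⌋₊ := by
  have hN' : (0 : ℝ) < N := by exact_mod_cast hN
  rw [Finset.sum_boole]
  congr 1
  have : (Finset.Icc 1 N).filter (fun k : ℕ => (k : ℝ) / N ≤ y) = Finset.Icc 1 ⌊N * y⌋₊ := by
    ext k
    simp only [Finset.mem_filter, Finset.mem_Icc]
    rw [div_le_iff₀ hN', mul_comm y, ← Nat.le_floor_iff (by positivity)]
    have : ⌊N * y⌋₊ ≤ N := by
      refine (Nat.floor_le_floor (mul_le_of_le_one_right hN'.le h1)).trans ?_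
      simp
    constructor
    · rintro ⟨⟨a, _⟩, b⟩; exact ⟨a, b⟩
    · rintro ⟨a, b⟩; exact ⟨⟨a, b.trans this⟩, b⟩
  rw [this]
  simp

/-- An open interval of length 2γN contains at most 2γN + 1 integers. -/
lemma sum_grid_near_le {N : ℕ} (hN : 0 < N) {γ : ℝ} (hγ : 0 < γ) (y : ℝ) :
    ∑ k ∈ Finset.Icc 1 N, (if |(k : ℝ) / N - y| < γ then (1 : ℝ) else 0) ≤ 2 * γ * N + 1 := by
  have hN' : (0 : ℝ) < N := by exact_mod_cast hN
  rw [Finset.sum_boole]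
  set a : ℝ := N * (y - γ)
  set b : ℝ := N * (y + γ)
  have hsub : ((Finset.Icc 1 N).filter (fun k : ℕ => |(k : ℝ) / N - y| < γ)).map
      ⟨((↑) : ℕ → ℤ), Nat.cast_injective⟩ ⊆ Finset.Icc (⌊a⌋ + 1) (⌈b⌉ - 1) := by
    intro k hk
    simp only [Finset.mem_map, Finset.mem_filter, Function.Embedding.coeFn_mk] at hk
    obtain ⟨k, ⟨-, hk⟩, rfl⟩ := hk
    rw [abs_lt] at hk
    have hka : a < k := by
      have : y - γ < k / N := by linarith [hk.1]
      rw [lt_div_iff₀ hN'] at this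
      simp only [a]; linarith
    have hkb : (k : ℝ) < b := by
      have : k / N < y + γ := by linarith [hk.2]
      rw [div_lt_iff₀ hN'] at this
      simp only [b]; linarith
    rw [Finset.mem_Icc]
    constructor
    · exact Int.add_one_le_of_lt (Int.floor_lt.2 (by exact_mod_cast hka))
    · exact Int.le_sub_one_of_lt (Int.lt_ceil.2 (by exact_mod_cast hkb))
  have hcard := Finset.card_le_card hsub
  rw [Finset.card_map, Int.card_Icc] at hcard
  have hab : b - a = 2 * γ * N := by simp only [a, b]; ring
  have h2 : ((⌈b⌉ - 1 + 1 - (⌊a⌋ + 1)).toNat : ℝ) ≤ 2 * γ * N + 1 := by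
    have hc : ((⌈b⌉ - 1 + 1 - (⌊a⌋ + 1) : ℤ) : ℝ) ≤ 2 * γ * N + 1 := by
      push_cast
      have := Int.ceil_lt_add_one b
      have := Int.lt_floor_add_one a
      linarith
    have : ((⌈b⌉ - 1 + 1 - (⌊a⌋ + 1)).toNat : ℝ) =
        ((max (⌈b⌉ - 1 + 1 - (⌊a⌋ + 1)) 0 : ℤ) : ℝ) := by
      rw [← Int.toNat_eq_max, Int.cast_natCast]
    rw [this, Int.cast_max]
    refine max_le hc ?_
    simp only [Int.cast_zero]; positivity
  exact (Nat.cast_le.2 hcard).trans h2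

/-- A measurable real-valued prediction rule, not using the label at the predicted index, whose
cumulative leave-one-out error is at most `4 γ m + V_H(γ)` on every sample realized by `H`. -/
lemma exists_leaveOneOut_rule [MeasurableSpace X] {H : Set (X → unitInterval)}
    (hH : IsMeasurableClass H) {γ : ℝ} (hγ : 0 < γ) {d : ℕ}
    (hd : vDim H γ = d) (m : ℕ) :
    ∃ q : Fin m → (Fin m → X × unitInterval) → ℝ,
      (∀ i, UniversallyMeasurable (q i)) ∧ (∀ i z, q i z ∈ Set.Icc (0 : ℝ) 1) ∧
      (∀ i z z', (z i).1 = (z' i).1 → (∀ j, j ≠ i → z j = z' j) → q i z = q i z') ∧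
      ∀ f ∈ H, ∀ z : Fin m → X × unitInterval, (∀ i, (z i).2 = f (z i).1) →
        ∑ i, |q i z - ((z i).2 : ℝ)| ≤ 4 * γ * m + d := by
  classical
  -- Mesh at most γ: the rounding error 1 / N and the extra grid point in `sum_grid_near_le` then
  -- each cost at most γ per index, for a total of γ + (2γ + γ) = 4γ.
  obtain ⟨N, hN1⟩ := exists_nat_ge (1 / γ)
  have hN' : (0 : ℝ) < N := (by positivity : 0 < 1 / γ).trans_le hN1
  have hN : 0 < N := by exact_mod_cast hN'
  have hNγ : 1 ≤ γ * N := by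
    rw [div_le_iff₀ hγ] at hN1; linarith
  have hrule : ∀ k : ℕ, ∃ h : Fin m → (Fin m → X × unitInterval) → ℝ,
      (∀ i, UniversallyMeasurable (h i)) ∧ (∀ i z, h i z ∈ Set.Icc (0 : ℝ) 1) ∧
      (∀ i z z', (z i).1 = (z' i).1 → (∀ j, j ≠ i → z j = z' j) → h i z = h i z') ∧
      (k ∈ Finset.Icc 1 N → ∀ f ∈ H, ∀ z : Fin m → X × unitInterval,
        (∀ i, (z i).2 = f (z i).1) →
        ∑ i, |h i z - if (k : ℝ) / N ≤ ((z i).2 : ℝ) then 1 else 0| ≤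
          d + ∑ i, if |(k : ℝ) / N - ((z i).2 : ℝ)| < γ then (1 : ℝ) else 0) := by
    intro k
    by_cases hk : k ∈ Finset.Icc 1 N
    · have hk' := Finset.mem_Icc.1 hk
      obtain ⟨h, a, b, c, e⟩ := exists_threshold_rule hH hγ (τ := (k : ℝ) / N) (by positivity)
        ((div_le_one hN').2 (by exact_mod_cast hk'.2)) hd m
      exact ⟨h, a, b, c, fun _ => e⟩
    · exact ⟨fun _ _ => 0, fun _ => measurable_const.universallyMeasurable, by simp, by simp,
        fun h => absurd h hk⟩
  choose h hmeas hIcc hcongr hloo using hrule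
  refine ⟨fun i z => (∑ k ∈ Finset.Icc 1 N, h k i z) / N, fun i μ hμ => ?_, fun i z => ⟨?_, ?_⟩,
    fun i z z' hi hj => ?_, fun f hf z hz => ?_⟩
  · exact (Finset.aemeasurable_fun_sum _ fun k _ => hmeas k i μ hμ).div_const _
  · exact div_nonneg (Finset.sum_nonneg fun k _ => (hIcc k i z).1) hN'.le
  · rw [div_le_one hN']
    refine (Finset.sum_le_card_nsmul _ _ 1 fun k _ => (hIcc k i z).2).trans ?_
    simp
  · simp only [fun k => hcongr k i z z' hi hj]
  · have hterm : ∀ i, |(∑ k ∈ Finset.Icc 1 N, h k i z) / N - ((z i).2 : ℝ)| ≤ γ +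
        (∑ k ∈ Finset.Icc 1 N, |h k i z - if (k : ℝ) / N ≤ ((z i).2 : ℝ) then 1 else 0|) / N := by
      intro i
      set y : ℝ := ((z i).2 : ℝ)
      have hfl := sum_grid_le_eq hN (z i).2.2.1 (z i).2.2.2
      have hy : |(∑ k ∈ Finset.Icc 1 N, (if (k : ℝ) / N ≤ y then (1 : ℝ) else 0)) / N - y| ≤ γ := by
        rw [hfl]
        have hy0 : 0 ≤ y := (z i).2.2.1
        have h1 := Nat.floor_le (show 0 ≤ N * y by positivity)
        have h2 := Nat.lt_floor_add_one (N * y)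
        have e1 : (⌊N * y⌋₊ : ℝ) / N ≤ y := by rw [div_le_iff₀ hN']; linarith
        have e2 : y - γ ≤ (⌊N * y⌋₊ : ℝ) / N := by rw [le_div_iff₀ hN']; nlinarith
        rw [abs_le]; constructor <;> linarith
      have hd' : |(∑ k ∈ Finset.Icc 1 N, h k i z) / N -
          (∑ k ∈ Finset.Icc 1 N, (if (k : ℝ) / N ≤ y then (1 : ℝ) else 0)) / N| ≤
          (∑ k ∈ Finset.Icc 1 N, |h k i z - if (k : ℝ) / N ≤ y then 1 else 0|) / N := by
        rw [← sub_div, ← Finset.sum_sub_distrib, abs_div, abs_of_pos hN']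
        gcongr
        exact Finset.abs_sum_le_sum_abs _ _
      refine (abs_sub_le _ ((∑ k ∈ Finset.Icc 1 N,
        (if (k : ℝ) / N ≤ y then (1 : ℝ) else 0)) / N) _).trans ?_
      rw [add_comm]
      exact add_le_add hy hd'
    refine (Finset.sum_le_sum fun i _ => hterm i).trans ?_
    rw [Finset.sum_add_distrib, ← Finset.sum_div, Finset.sum_comm]
    have h1 : ∑ k ∈ Finset.Icc 1 N, ∑ i,
        |h k i z - if (k : ℝ) / N ≤ ((z i).2 : ℝ) then 1 else 0| ≤
        N * d + m * (2 * γ * N + 1) := by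
      refine (Finset.sum_le_sum fun k hk => hloo k hk f hf z hz).trans ?_
      rw [Finset.sum_add_distrib, Finset.sum_comm]
      refine add_le_add (by simp) ?_
      refine (Finset.sum_le_sum fun i _ => sum_grid_near_le hN hγ ((z i).2 : ℝ)).trans ?_
      rw [Finset.sum_const, Finset.card_univ, Fintype.card_fin, nsmul_eq_mul]
    have h2 : (N * d + m * (2 * γ * N + 1)) / (N : ℝ) ≤ d + 3 * γ * m := by
      rw [div_le_iff₀ hN']
      have : (m : ℝ) * 1 ≤ m * (γ * N) := by gcongr
      nlinarith
    have h3 := (div_le_div_of_nonneg_right h1 hN'.le).trans h2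
    simp only [Finset.sum_const, Finset.card_univ, Fintype.card_fin, nsmul_eq_mul]
    linarith

end RealRule

/-! ### Symmetrizing the rule over orderings of the sample. -/

section Symmetrization

/-- Averaging a leave-one-out rule over all orderings of the sample: the label at the last index is
predicted, symmetrically in all other entries. -/
lemma exists_symmetric_leaveOneOut_rule {X : Type*} [MeasurableSpace X]
    {H : Set (X → unitInterval)} (hH : IsMeasurableClass H) {γ : ℝ} (hγ : 0 < γ) {d : ℕ}
    (hd : vDim H γ = d) (t : ℕ) :
    ∃ Q : (Fin (t + 1) → X × unitInterval) → ℝ,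
      UniversallyMeasurable Q ∧ (∀ z, Q z ∈ Set.Icc (0 : ℝ) 1) ∧
      (∀ (s : Fin t → X × unitInterval) x y y',
        Q (Fin.snoc s (x, y)) = Q (Fin.snoc s (x, y'))) ∧
      (∀ (ρ : Equiv.Perm (Fin (t + 1))) z, ρ (Fin.last t) = Fin.last t →
        Q (fun j => z (ρ j)) = Q z) ∧
      ∀ f ∈ H, ∀ z : Fin (t + 1) → X × unitInterval, (∀ i, (z i).2 = f (z i).1) →
        ∑ i, |Q (fun j => z (Equiv.swap i (Fin.last t) j)) - ((z i).2 : ℝ)| ≤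
          4 * γ * (t + 1) + d := by
  obtain ⟨q, hmeas, hIcc, hcongr, hloo⟩ := exists_leaveOneOut_rule hH hγ hd (t + 1)
  set K : ℝ := (Fintype.card (Equiv.Perm (Fin (t + 1))) : ℝ) with hK
  have hKpos : 0 < K := Nat.cast_pos.2 Fintype.card_pos
  -- After reordering by `π`, the last entry of `z` sits at position `π⁻¹ (Fin.last t)`, so that is
  -- where `q` must predict.
  let Q : (Fin (t + 1) → X × unitInterval) → ℝ := fun z =>
    (∑ π : Equiv.Perm (Fin (t + 1)), q (π⁻¹ (Fin.last t)) (fun j => z (π j))) / K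
  have hshift : ∀ (ρ : Equiv.Perm (Fin (t + 1))) (z : Fin (t + 1) → X × unitInterval),
      Q (fun j => z (ρ j)) =
        (∑ π : Equiv.Perm (Fin (t + 1)), q (π⁻¹ (ρ (Fin.last t))) (fun j => z (π j))) / K := by
    intro ρ z
    refine congrArg (· / K) ?_
    rw [← Equiv.sum_comp (Equiv.mulLeft ρ)
      (fun π : Equiv.Perm (Fin (t + 1)) => q (π⁻¹ (ρ (Fin.last t))) (fun j => z (π j)))]
    refine Finset.sum_congr rfl fun π _ => ?_
    simp [mul_inv_rev, Equiv.Perm.mul_apply]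
  refine ⟨Q, fun μ hμ => ?_, fun z => ⟨?_, ?_⟩, fun s x y y' => ?_, fun ρ z hρ => ?_,
    fun f hf z hz => ?_⟩
  · refine (Finset.aemeasurable_fun_sum _ fun π _ => ?_).div_const _
    exact (hmeas _).comp_measurable (g := fun z : Fin (t + 1) → X × unitInterval =>
      fun j => z (π j)) (by fun_prop) μ hμ
  · exact div_nonneg (Finset.sum_nonneg fun π _ => (hIcc _ _).1) hKpos.le
  · rw [div_le_one hKpos]
    refine (Finset.sum_le_card_nsmul _ _ 1 fun π _ => (hIcc _ _).2).trans ?_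
    simp [hK]
  · refine congrArg (· / K) (Finset.sum_congr rfl fun π _ => hcongr _ _ _ ?_ fun j hj => ?_)
    · simp
    · have hne : π j ≠ Fin.last t := fun h => hj (by rw [← h]; simp)
      obtain ⟨k, hk⟩ := Fin.exists_castSucc_eq.2 hne
      rw [← hk, Fin.snoc_castSucc, Fin.snoc_castSucc]
  · rw [hshift, hρ]
  · have hterm : ∀ i, |Q (fun j => z (Equiv.swap i (Fin.last t) j)) - ((z i).2 : ℝ)| ≤
        (∑ π : Equiv.Perm (Fin (t + 1)),
          |q (π⁻¹ i) (fun j => z (π j)) - ((z i).2 : ℝ)|) / K := by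
      intro i
      have h1 : Q (fun j => z (Equiv.swap i (Fin.last t) j)) =
          (∑ π : Equiv.Perm (Fin (t + 1)), q (π⁻¹ i) (fun j => z (π j))) / K := by
        rw [hshift, Equiv.swap_apply_right]
      have h2 : ((z i).2 : ℝ) = (∑ _π : Equiv.Perm (Fin (t + 1)), ((z i).2 : ℝ)) / K := by
        rw [Finset.sum_const, nsmul_eq_mul, Finset.card_univ, ← hK]
        field_simp
      rw [h1]
      nth_rewrite 1 [h2]
      rw [← sub_div, ← Finset.sum_sub_distrib, abs_div, abs_of_pos hKpos]
      gcongr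
      exact Finset.abs_sum_le_sum_abs _ _
    refine (Finset.sum_le_sum fun i _ => hterm i).trans ?_
    rw [← Finset.sum_div, Finset.sum_comm, div_le_iff₀ hKpos]
    refine (Finset.sum_le_card_nsmul _ _ (4 * γ * (t + 1) + d) fun π _ => ?_).trans ?_
    -- For a fixed ordering, summing over `i` is one leave-one-out sum for the reordered sample.
    · have := hloo f hf (fun j => z (π j)) fun i => hz (π i)
      push_cast at this
      refine le_trans (le_of_eq ?_) this
      rw [← Equiv.sum_comp π]
      simp
    · rw [nsmul_eq_mul, Finset.card_univ, ← hK, mul_comm]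

end Symmetrization

/-! ### Exponential moments of prefix sums, forward and backward in time. -/

/-- Sum along a sample of functions of its initial segments. -/
def prefixSum {Z : Type*} (e : ∀ t, (Fin (t + 1) → Z) → ℝ) (n : ℕ) (z : Fin n → Z) : ℝ :=
  ∑ t : Fin n, e t (fun i => z (Fin.castLE t.2 i))

lemma prefixSum_succ {Z : Type*} (e : ∀ t, (Fin (t + 1) → Z) → ℝ) (n : ℕ) (z : Fin (n + 1) → Z) :
    prefixSum e (n + 1) z = prefixSum e n (Fin.init z) + e n z := by
  rw [prefixSum, Fin.sum_univ_castSucc]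
  rfl

section Concentration

variable {Z : Type*} [MeasurableSpace Z]

lemma measurable_fin_snoc (t : ℕ) :
    Measurable fun p : (Fin t → Z) × Z => (Fin.snoc p.1 p.2 : Fin (t + 1) → Z) := by
  refine measurable_pi_iff.2 fun i => ?_
  induction i using Fin.lastCases with
  | last => simpa using measurable_snd
  | cast j =>
    simp only [Fin.snoc_castSucc]
    fun_prop

lemma measurable_fin_init (t : ℕ) :
    Measurable fun z : Fin (t + 1) → Z => (Fin.init z : Fin t → Z) :=
  measurable_pi_iff.2 fun _ => measurable_pi_apply _

lemma lintegral_pi_comp_perm {n : ℕ} (P : Measure Z) [IsProbabilityMeasure P]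
    (σ : Equiv.Perm (Fin n)) (F : (Fin n → Z) → ENNReal) :
    ∫⁻ z, F (fun j => z (σ j)) ∂Measure.pi (fun _ => P) = ∫⁻ z, F z ∂Measure.pi (fun _ => P) := by
  have h := measurePreserving_arrowCongr' (fun _ : Fin n => P) (fun _ : Fin n => P) σ.symm
    (MeasurableEquiv.refl Z) (fun _ => MeasurePreserving.id P)
  exact h.lintegral_comp_emb (MeasurableEquiv.measurableEmbedding _) F

lemma lintegral_pi_succ_eq {n : ℕ} (P : Measure Z) [IsProbabilityMeasure P]
    (F : (Fin (n + 1) → Z) → ENNReal) :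
    ∫⁻ z, F z ∂Measure.pi (fun _ => P) =
      ∫⁻ p, F (Fin.snoc p.2 p.1) ∂P.prod (Measure.pi fun _ : Fin n => P) := by
  have h := (measurePreserving_piFinSuccAbove (fun _ : Fin (n + 1) => P) (Fin.last n)).symm
  rw [← h.lintegral_comp_emb (MeasurableEquiv.measurableEmbedding _) F]
  refine lintegral_congr fun p => ?_
  congr 1
  exact Fin.insertNth_last' _ _

lemma universallyMeasurable_prefixSum {e : ∀ t, (Fin (t + 1) → Z) → ℝ}
    (he : ∀ t, UniversallyMeasurable (e t)) (n : ℕ) : UniversallyMeasurable (prefixSum e n) :=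
  fun μ hμ => Finset.aemeasurable_fun_sum _ fun t _ => (he t).comp_measurable
    (g := fun z : Fin n → Z => fun i : Fin (t + 1) => z (Fin.castLE t.2 i)) (by fun_prop) μ hμ

lemma universallyMeasurable_exp {α : Type*} [MeasurableSpace α] {e : α → ℝ}
    (he : UniversallyMeasurable e) :
    UniversallyMeasurable fun z => ENNReal.ofReal (Real.exp (e z)) :=
  (ENNReal.measurable_ofReal.comp Real.measurable_exp).comp_universallyMeasurable he

/-- Exponential supermartingale bound. -/
lemma lintegral_exp_prefixSum_le_one {g : ∀ t, (Fin (t + 1) → Z) → ℝ} (P : Measure Z)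
    [IsProbabilityMeasure P] (hg : ∀ t, UniversallyMeasurable (g t))
    (hint : ∀ t (s : Fin t → Z),
      ∫⁻ w, ENNReal.ofReal (Real.exp (g t (Fin.snoc s w))) ∂P ≤ 1) (n : ℕ) :
    ∫⁻ z, ENNReal.ofReal (Real.exp (prefixSum g n z)) ∂Measure.pi (fun _ => P) ≤ 1 := by
  induction n with
  | zero => simp [prefixSum]
  | succ n ih =>
    have hm : UniversallyMeasurable fun p : Z × (Fin n → Z) =>
        ENNReal.ofReal (Real.exp (prefixSum g (n + 1) (Fin.snoc p.2 p.1))) :=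
      (universallyMeasurable_exp (universallyMeasurable_prefixSum hg (n + 1))).comp_measurable
        ((measurable_fin_snoc n).comp measurable_swap)
    rw [lintegral_pi_succ_eq, lintegral_prod_symm _ (hm _ inferInstance)]
    refine (lintegral_mono fun s => ?_).trans ih
    simp only [prefixSum_succ, Fin.init_snoc, Real.exp_add]
    simp_rw [ENNReal.ofReal_mul (Real.exp_nonneg _)]
    rw [lintegral_const_mul' _ _ ENNReal.ofReal_ne_top]
    exact mul_le_of_le_one_right' (hint n s)

/-- Exponential bound along the reversed (exchangeable) filtration, with a symmetric weight. -/
lemma lintegral_exp_prefixSum_mul_le {g : ∀ t, (Fin (t + 1) → Z) → ℝ} (P : Measure Z)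
    [IsProbabilityMeasure P] (hg : ∀ t, UniversallyMeasurable (g t))
    (hsymm : ∀ t (ρ : Equiv.Perm (Fin (t + 1))) z, ρ (Fin.last t) = Fin.last t →
      g t (fun j => z (ρ j)) = g t z)
    (hsum : ∀ t, ∀ᵐ z ∂Measure.pi (fun _ : Fin (t + 1) => P),
      ∑ i, ENNReal.ofReal (Real.exp (g t (fun j => z (Equiv.swap i (Fin.last t) j)))) ≤
        (t + 1 : ℕ)) (n : ℕ) :
    ∀ W : (Fin n → Z) → ENNReal, UniversallyMeasurable W →
      (∀ (ρ : Equiv.Perm (Fin n)) z, W (fun j => z (ρ j)) = W z) →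
      ∫⁻ z, ENNReal.ofReal (Real.exp (prefixSum g n z)) * W z ∂Measure.pi (fun _ => P) ≤
        ∫⁻ z, W z ∂Measure.pi (fun _ => P) := by
  induction n with
  | zero => intro W _ _; simp [prefixSum]
  | succ n ih =>
    intro W hW hWs
    -- The last increment is absorbed into the weight. With the last point frozen, `V` is symmetric
    -- in the remaining ones, so the induction hypothesis removes all earlier increments.
    set V : (Fin (n + 1) → Z) → ENNReal := fun z => ENNReal.ofReal (Real.exp (g n z)) * W z
      with hV
    have hVm : UniversallyMeasurable V := fun μ hμ =>
      (universallyMeasurable_exp (hg n) μ hμ).mul (hW μ hμ)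
    have hVsnoc : ∀ w, UniversallyMeasurable fun s : Fin n → Z => V (Fin.snoc s w) := fun w =>
      hVm.comp_measurable ((measurable_fin_snoc n).comp (measurable_id.prodMk measurable_const))
    have hVp : UniversallyMeasurable fun p : Z × (Fin n → Z) => V (Fin.snoc p.2 p.1) :=
      hVm.comp_measurable ((measurable_fin_snoc n).comp measurable_swap)
    have hVs : ∀ w (ρ : Equiv.Perm (Fin n)) (s : Fin n → Z),
        V (Fin.snoc (fun j => s (ρ j)) w) = V (Fin.snoc s w) := by
      intro w ρ s
      let ρ' : Equiv.Perm (Fin (n + 1)) :=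
        finSuccEquivLast.trans ((Equiv.optionCongr ρ).trans finSuccEquivLast.symm)
      have hlast : ρ' (Fin.last n) = Fin.last n := by simp [ρ']
      have hcast : ∀ j : Fin n, ρ' j.castSucc = (ρ j).castSucc := by intro j; simp [ρ']
      have : (Fin.snoc (fun j => s (ρ j)) w : Fin (n + 1) → Z) =
          fun j => (Fin.snoc s w : Fin (n + 1) → Z) (ρ' j) := by
        funext j
        induction j using Fin.lastCases with
        | last => simp [hlast]
        | cast j => simp [hcast]
      rw [this]
      simp only [hV]
      rw [hsymm n ρ' _ hlast, hWs ρ']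
    have hEp : UniversallyMeasurable fun p : Z × (Fin n → Z) =>
        ENNReal.ofReal (Real.exp (prefixSum g n p.2)) * V (Fin.snoc p.2 p.1) := fun μ hμ =>
      ((universallyMeasurable_exp (universallyMeasurable_prefixSum hg n)).comp_measurable
        measurable_snd μ hμ).mul (hVp μ hμ)
    have hstep : ∫⁻ z, ENNReal.ofReal (Real.exp (prefixSum g (n + 1) z)) * W z
        ∂Measure.pi (fun _ => P) ≤ ∫⁻ z, V z ∂Measure.pi (fun _ => P) := by
      rw [lintegral_pi_succ_eq, lintegral_pi_succ_eq]
      simp only [prefixSum_succ, Fin.init_snoc, Real.exp_add]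
      simp_rw [ENNReal.ofReal_mul (Real.exp_nonneg _), mul_assoc]
      rw [lintegral_prod _ (hVp _ inferInstance)]
      refine (lintegral_prod _ (hEp _ inferInstance)).trans_le ?_
      exact lintegral_mono fun w => ih _ (hVsnoc w) (hVs w)
    refine hstep.trans ?_
    -- Exchangeability: swapping any index into last place leaves the integral unchanged and fixes
    -- `W`, so `hsum` can be applied to the sum over all swaps.
    have hex : ∀ i : Fin (n + 1), ∫⁻ z, V z ∂Measure.pi (fun _ => P) =
        ∫⁻ z, ENNReal.ofReal (Real.exp (g n (fun j => z (Equiv.swap i (Fin.last n) j)))) * W z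
          ∂Measure.pi (fun _ => P) := by
      intro i
      rw [← lintegral_pi_comp_perm P (Equiv.swap i (Fin.last n)) V]
      simp only [hV, hWs]
    have hmul : ((n + 1 : ℕ) : ENNReal) * ∫⁻ z, V z ∂Measure.pi (fun _ => P) ≤
        ((n + 1 : ℕ) : ENNReal) * ∫⁻ z, W z ∂Measure.pi (fun _ => P) := by
      have h1 : ((n + 1 : ℕ) : ENNReal) * ∫⁻ z, V z ∂Measure.pi (fun _ => P) =
          ∑ i : Fin (n + 1), ∫⁻ z,
            ENNReal.ofReal (Real.exp (g n (fun j => z (Equiv.swap i (Fin.last n) j)))) * W z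
            ∂Measure.pi (fun _ => P) := by
        rw [← Finset.sum_congr rfl fun i _ => hex i]
        simp
      rw [h1, ← lintegral_finsetSum', ← lintegral_const_mul' _ _ (ENNReal.natCast_ne_top _)]
      · refine lintegral_mono_ae ?_
        filter_upwards [hsum n] with z hz
        rw [← Finset.sum_mul]
        gcongr
      · intro i _
        refine AEMeasurable.mul ?_ (hW _ inferInstance)
        exact (universallyMeasurable_exp (hg n)).comp_measurable
          (g := fun z : Fin (n + 1) → Z => fun j => z (Equiv.swap i (Fin.last n) j))
          (by fun_prop) _ inferInstance
    exact (ENNReal.mul_le_mul_iff_right (by simp) (ENNReal.natCast_ne_top _)).1 hmul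

lemma exp_le_one_add_two_mul {x : ℝ} (h0 : 0 ≤ x) (h1 : x ≤ 1) : Real.exp x ≤ 1 + 2 * x := by
  have := Real.abs_exp_sub_one_sub_id_le (x := x) (by rwa [abs_of_nonneg h0])
  have := (abs_le.1 this).2
  nlinarith

lemma exp_neg_le_one_sub_half {x : ℝ} (h0 : 0 ≤ x) (h1 : x ≤ 1) :
    Real.exp (-x) ≤ 1 - x / 2 := by
  have h2 := Real.add_one_le_exp x
  rw [Real.exp_neg, inv_le_iff_one_le_mul₀ (Real.exp_pos x)]
  nlinarith

lemma integrable_of_universallyMeasurable {α : Type*} [MeasurableSpace α] (P : Measure α)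
    [IsProbabilityMeasure P] {h : α → ℝ} (hm : UniversallyMeasurable h)
    (hI : ∀ w, h w ∈ Set.Icc (0 : ℝ) 1) : Integrable h P :=
  Integrable.of_bound (hm P inferInstance).aestronglyMeasurable 1 <|
    Filter.Eventually.of_forall fun w => by
      rw [Real.norm_eq_abs, abs_of_nonneg (hI w).1]; exact (hI w).2

/-- With R the mean of `h`, E exp(-h) ≤ 1 - R / 2 ≤ exp(-R / 2). -/
lemma lintegral_exp_half_integral_sub_le_one (P : Measure Z) [IsProbabilityMeasure P] {h : Z → ℝ}
    (hm : UniversallyMeasurable h) (hI : ∀ w, h w ∈ Set.Icc (0 : ℝ) 1) :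
    ∫⁻ w, ENNReal.ofReal (Real.exp ((∫ w, h w ∂P) / 2 - h w)) ∂P ≤ 1 := by
  have hi := integrable_of_universallyMeasurable P hm hI
  set R := ∫ w, h w ∂P
  have hle : ∀ w, ENNReal.ofReal (Real.exp (R / 2 - h w)) ≤
      ENNReal.ofReal (Real.exp (R / 2) * (1 - h w / 2)) := by
    intro w
    refine ENNReal.ofReal_le_ofReal ?_
    rw [sub_eq_add_neg, Real.exp_add]
    gcongr
    exact exp_neg_le_one_sub_half (hI w).1 (hI w).2
  refine (lintegral_mono hle).trans ?_
  rw [← ofReal_integral_eq_lintegral_ofReal]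
  · rw [integral_const_mul, integral_sub (integrable_const _) (hi.div_const _), integral_div]
    simp only [integral_const, probReal_univ, smul_eq_mul, mul_one]
    rw [← ENNReal.ofReal_one]
    refine ENNReal.ofReal_le_ofReal ?_
    have h1 : 1 - R / 2 ≤ Real.exp (-(R / 2)) := by
      have := Real.add_one_le_exp (-(R / 2)); linarith
    calc Real.exp (R / 2) * (1 - R / 2) ≤ Real.exp (R / 2) * Real.exp (-(R / 2)) := by gcongr
      _ = 1 := by rw [← Real.exp_add]; simp
  · exact ((integrable_const _).sub (hi.div_const _)).const_mul _
  · refine Filter.Eventually.of_forall fun w => ?_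
    have := (hI w).2
    exact mul_nonneg (Real.exp_nonneg _) (by linarith)

/-- Online-to-batch conversion with exchangeability: if the losses have leave-one-out averages at
most `c t`, the cumulative risk along the sample is of order `∑ c t + log (1 / δ)`. -/
lemma measure_prefixSum_risk_le (P : Measure Z) [IsProbabilityMeasure P]
    {l : ∀ t, (Fin (t + 1) → Z) → ℝ} {c : ℕ → ℝ} (hl : ∀ t, UniversallyMeasurable (l t))
    (hI : ∀ t z, l t z ∈ Set.Icc (0 : ℝ) 1)
    (hsymm : ∀ t (ρ : Equiv.Perm (Fin (t + 1))) z, ρ (Fin.last t) = Fin.last t →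
      l t (fun j => z (ρ j)) = l t z)
    (hloo : ∀ t, ∀ᵐ z ∂Measure.pi (fun _ : Fin (t + 1) => P),
      ∑ i, l t (fun j => z (Equiv.swap i (Fin.last t) j)) ≤ c t * (t + 1))
    (n : ℕ) {δ : ℝ} (hδ : 0 < δ) :
    Measure.pi (fun _ : Fin n => P)
      {z | ¬ prefixSum (fun t z => ∫ w, l t (Fin.snoc (Fin.init z) w) ∂P) n z ≤
        4 * ∑ t : Fin n, c t + 4 * Real.log (1 / δ)} ≤ ENNReal.ofReal δ := by
  set r : ∀ t, (Fin (t + 1) → Z) → ℝ := fun t z => ∫ w, l t (Fin.snoc (Fin.init z) w) ∂P with hr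
  have hrm : ∀ t, UniversallyMeasurable (r t) := by
    intro t
    have : UniversallyMeasurable fun s : Fin t → Z => ∫ w, l t (Fin.snoc s w) ∂P := by
      intro μ hμ
      have h := (hl t).comp_measurable (measurable_fin_snoc t) (μ.prod P) inferInstance
      exact (h.aestronglyMeasurable.integral_prod_right').aemeasurable
    exact this.comp_measurable (measurable_fin_init t)
  have hfwd := lintegral_exp_prefixSum_le_one P (g := fun t z => r t z / 2 - l t z)
    (fun t μ hμ => ((hrm t μ hμ).div_const _).sub (hl t μ hμ))
    (fun t s => by
      simp only [hr, Fin.init_snoc]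
      exact lintegral_exp_half_integral_sub_le_one P
        ((hl t).comp_measurable ((measurable_fin_snoc t).comp measurable_prodMk_left))
        fun w => hI t _) n
  -- Averaging exp l ≤ 1 + 2l over the swaps gives at most 1 + 2c ≤ exp(2c), which the compensator
  -- 2c cancels.
  have hbwd := lintegral_exp_prefixSum_mul_le P (g := fun t z => l t z - 2 * c t)
    (fun t μ hμ => (hl t μ hμ).sub_const _)
    (fun t ρ z hρ => by simp only [hsymm t ρ z hρ])
    (fun t => by
      filter_upwards [hloo t] with z hz
      rw [← ENNReal.ofReal_sum_of_nonneg fun _ _ => Real.exp_nonneg _, ← ENNReal.ofReal_natCast]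
      refine ENNReal.ofReal_le_ofReal ?_
      simp only [sub_eq_add_neg, Real.exp_add]
      rw [← Finset.sum_mul]
      have h1 : ∑ i, Real.exp (l t fun j => z (Equiv.swap i (Fin.last t) j)) ≤
          (t + 1) * Real.exp (2 * c t) := by
        refine (Finset.sum_le_sum fun i _ =>
          exp_le_one_add_two_mul (hI t _).1 (hI t _).2).trans ?_
        rw [Finset.sum_add_distrib, ← Finset.mul_sum]
        simp only [Finset.sum_const, Finset.card_univ, Fintype.card_fin, nsmul_eq_mul, mul_one,
          Nat.cast_add, Nat.cast_one]
        have h2 := Real.add_one_le_exp (2 * c t)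
        have h3 : ((t : ℝ) + 1) * (2 * c t + 1) ≤ (t + 1) * Real.exp (2 * c t) := by gcongr
        linarith
      calc _ ≤ (t + 1) * Real.exp (2 * c t) * Real.exp (-(2 * c t)) := by gcongr
        _ = ((t + 1 : ℕ) : ℝ) := by
          rw [mul_assoc, ← Real.exp_add]; simp) n (fun _ => 1)
    (fun μ _ => aemeasurable_const) (fun _ _ => rfl)
  simp only [mul_one, lintegral_const, measure_univ] at hbwd
  set U : (Fin n → Z) → ℝ := fun z => prefixSum r n z / 4 - ∑ t : Fin n, c t with hU
  have hUm : UniversallyMeasurable U := fun μ hμ =>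
    ((universallyMeasurable_prefixSum hrm n μ hμ).div_const _).sub_const _
  -- `U` is the midpoint of the forward and backward exponents, in which the losses cancel; AM-GM
  -- bounds its exponential by the mean of the two.
  have hmean : ∫⁻ z, ENNReal.ofReal (Real.exp (U z)) ∂Measure.pi (fun _ : Fin n => P) ≤ 1 := by
    have hpt : ∀ z, ENNReal.ofReal (Real.exp (U z)) ≤
        2⁻¹ * (ENNReal.ofReal (Real.exp (prefixSum (fun t z => r t z / 2 - l t z) n z)) +
          ENNReal.ofReal (Real.exp (prefixSum (fun t z => l t z - 2 * c t) n z))) := by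
      intro z
      set a := prefixSum (fun t z => r t z / 2 - l t z) n z with ha
      set b := prefixSum (fun t z => l t z - 2 * c t) n z with hb
      have hab : U z = a / 2 + b / 2 := by
        simp only [hU, ha, hb, prefixSum, Finset.sum_sub_distrib, ← Finset.sum_div,
          ← Finset.mul_sum]
        ring
      have hle : Real.exp (U z) ≤ 2⁻¹ * (Real.exp a + Real.exp b) := by
        have e1 : Real.exp a = Real.exp (a / 2) ^ 2 := by rw [← Real.exp_nat_mul]; congr 1; ring
        have e2 : Real.exp b = Real.exp (b / 2) ^ 2 := by rw [← Real.exp_nat_mul]; congr 1; ring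
        rw [hab, Real.exp_add, e1, e2]
        nlinarith [sq_nonneg (Real.exp (a / 2) - Real.exp (b / 2))]
      refine (ENNReal.ofReal_le_ofReal hle).trans (le_of_eq ?_)
      rw [ENNReal.ofReal_mul (by norm_num), ENNReal.ofReal_add (Real.exp_nonneg _)
        (Real.exp_nonneg _), ENNReal.ofReal_inv_of_pos (by norm_num)]
      simp
    refine (lintegral_mono hpt).trans ?_
    rw [lintegral_const_mul' _ _ (by simp), lintegral_add_left']
    · refine (mul_le_mul_right (add_le_add hfwd hbwd) _).trans ?_
      rw [one_add_one_eq_two, ENNReal.inv_mul_cancel (by simp) (by simp)]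
    · exact universallyMeasurable_exp (universallyMeasurable_prefixSum
        (fun t μ hμ => ((hrm t μ hμ).div_const _).sub (hl t μ hμ)) n) _ inferInstance
  have hsub : {z | ¬ prefixSum r n z ≤ 4 * ∑ t : Fin n, c t + 4 * Real.log (1 / δ)} ⊆
      {z | ENNReal.ofReal (1 / δ) ≤ ENNReal.ofReal (Real.exp (U z))} := by
    intro z hz
    simp only [Set.mem_ofPred_eq, not_le] at hz ⊢
    refine ENNReal.ofReal_le_ofReal ?_
    rw [← Real.log_le_iff_le_exp (by positivity)]
    simp only [hU]
    linarith
  refine (measure_mono hsub).trans ?_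
  refine (meas_ge_le_lintegral_div (universallyMeasurable_exp hUm _ inferInstance)
    (by simpa using hδ) ENNReal.ofReal_ne_top).trans ?_
  refine (ENNReal.div_le_div_right hmean _).trans (le_of_eq ?_)
  rw [one_div, one_div, ENNReal.ofReal_inv_of_pos hδ, inv_inv]

end Concentration

/-! ### The tail-averaged predictor and its risk. -/

section FinalPredictor

variable {X : Type*} [MeasurableSpace X]

/-- The prediction at `x` obtained by averaging the rules `Q t`, trained on the initial segments of
length `t ∈ [n / 2, n)` of the sample. -/
noncomputable def tailAverage (Q : ∀ t, (Fin (t + 1) → X × unitInterval) → ℝ) (x : X) (n : ℕ)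
    (S : Fin n → X × unitInterval) : ℝ :=
  prefixSum (fun t z => if n / 2 ≤ t then Q t (Fin.snoc (Fin.init z) (x, 0)) else 0) n S /
    (n - n / 2 : ℕ)

/-- The predictor with values in `[0,1]` given by `tailAverage`. -/
noncomputable def tailPredictor (Q : ∀ t, (Fin (t + 1) → X × unitInterval) → ℝ) :
    Predictor X unitInterval :=
  fun x S => Set.projIcc 0 1 zero_le_one (tailAverage Q x S.1 S.2)

lemma isMeasurable_tailPredictor {Q : ∀ t, (Fin (t + 1) → X × unitInterval) → ℝ}
    (hQ : ∀ t, UniversallyMeasurable (Q t)) : (tailPredictor Q).IsMeasurable := by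
  intro n
  refine continuous_projIcc.measurable.comp_universallyMeasurable
    (g := fun p : X × (Fin n → X × unitInterval) => tailAverage Q p.1 n p.2) ?_
  intro μ hμ
  refine (Finset.aemeasurable_fun_sum _ fun t _ => ?_).div_const _
  by_cases h : n / 2 ≤ (t : ℕ)
  · simp only [h, if_true]
    refine (hQ t).comp_measurable (g := fun p : X × (Fin n → X × unitInterval) =>
      (Fin.snoc (Fin.init fun i => p.2 (Fin.castLE t.2 i)) (p.1, 0) :
        Fin ((t : ℕ) + 1) → X × unitInterval)) ?_ μ hμ
    have hinit : Measurable fun p : X × (Fin n → X × unitInterval) =>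
        (Fin.init fun i : Fin ((t : ℕ) + 1) => p.2 (Fin.castLE t.2 i) :
          Fin (t : ℕ) → X × unitInterval) :=
      measurable_pi_iff.2 fun _ => (measurable_pi_apply _).comp measurable_snd
    exact (measurable_fin_snoc (t : ℕ)).comp
      (hinit.prodMk (measurable_fst.prodMk measurable_const))
  · simp only [h, if_false]
    exact aemeasurable_const

lemma sum_fin_ite_half (n : ℕ) :
    ∑ t : Fin n, (if n / 2 ≤ (t : ℕ) then (1 : ℝ) else 0) = (n - n / 2 : ℕ) := by
  rw [Fin.sum_univ_eq_sum_range (fun t => if n / 2 ≤ t then (1 : ℝ) else 0) n, Finset.sum_boole]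
  have : (Finset.range n).filter (fun t => n / 2 ≤ t) = Finset.Ico (n / 2) n := by
    ext t; simp [and_comm]
  rw [this, Nat.card_Ico]

/-- Convexity of the absolute loss. The projection to `[0,1]` is inactive, since an average of
values in `[0,1]` stays there. -/
lemma absRisk_tailPredictor_le {Q : ∀ t, (Fin (t + 1) → X × unitInterval) → ℝ}
    (hQ : ∀ t, UniversallyMeasurable (Q t)) (hI : ∀ t z, Q t z ∈ Set.Icc (0 : ℝ) 1)
    (hlab : ∀ t (s : Fin t → X × unitInterval) x y y',
      Q t (Fin.snoc s (x, y)) = Q t (Fin.snoc s (x, y')))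
    (P : Measure (X × unitInterval)) [IsProbabilityMeasure P] {n : ℕ} (hn : 1 ≤ n)
    (S : Fin n → X × unitInterval) :
    absRisk P (fun x => tailPredictor Q x ⟨n, S⟩) ≤
      prefixSum (fun t z => ∫ w, (if n / 2 ≤ t then
        |Q t (Fin.snoc (Fin.init z) w) - (w.2 : ℝ)| else 0) ∂P) n S / (n - n / 2 : ℕ) := by
  have hK : 0 < n - n / 2 := by omega
  have hK' : (0 : ℝ) < (n - n / 2 : ℕ) := by exact_mod_cast hK
  set K : ℝ := ((n - n / 2 : ℕ) : ℝ) with hKdef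
  let l : Fin n → X × unitInterval → ℝ := fun t w => if n / 2 ≤ (t : ℕ) then
    |Q t (Fin.snoc (Fin.init fun i : Fin ((t : ℕ) + 1) => S (Fin.castLE t.2 i)) w) - (w.2 : ℝ)|
    else 0
  have hl : ∀ t, Integrable (l t) P := by
    intro t
    simp only [l]
    by_cases h : n / 2 ≤ (t : ℕ)
    · simp only [h, if_true]
      refine Integrable.abs (Integrable.sub ?_ ?_)
      · have hs : ∀ s : Fin (t : ℕ) → X × unitInterval, Measurable fun w : X × unitInterval =>
            (Fin.snoc s w : Fin ((t : ℕ) + 1) → X × unitInterval) := fun s =>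
          (measurable_fin_snoc (t : ℕ)).comp (measurable_const.prodMk measurable_id)
        exact integrable_of_universallyMeasurable P ((hQ t).comp_measurable (hs _)) fun w => hI t _
      · exact integrable_of_universallyMeasurable P
          (Measurable.universallyMeasurable (by fun_prop)) fun w => w.2.2
    · simp only [h, if_false]
      exact integrable_zero _ _ _
  have hrhs : prefixSum (fun t z => ∫ w, (if n / 2 ≤ t then
        |Q t (Fin.snoc (Fin.init z) w) - (w.2 : ℝ)| else 0) ∂P) n S / K =
      ∫ w, (∑ t, l t w) / K ∂P := by
    rw [integral_div, integral_finsetSum _ fun t _ => hl t]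
    rfl
  rw [hrhs]
  refine integral_mono_of_nonneg (Filter.Eventually.of_forall fun _ => abs_nonneg _)
    ((integrable_finsetSum _ fun t _ => hl t).div_const _) (Filter.Eventually.of_forall ?_)
  rintro ⟨x, y⟩
  set a : Fin n → ℝ := fun t => if n / 2 ≤ (t : ℕ) then
    Q t (Fin.snoc (Fin.init fun i : Fin ((t : ℕ) + 1) => S (Fin.castLE t.2 i)) (x, y)) else 0
    with ha
  have havg : tailAverage Q x n S = (∑ t, a t) / K := by
    refine congrArg (· / K) (Finset.sum_congr rfl fun t _ => ?_)
    simp only [ha]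
    rw [hlab t _ x 0 y]
  have hmem : tailAverage Q x n S ∈ Set.Icc (0 : ℝ) 1 := by
    rw [havg]
    constructor
    · refine div_nonneg (Finset.sum_nonneg fun t _ => ?_) hK'.le
      simp only [ha]
      split_ifs
      · exact (hI _ _).1
      · exact le_rfl
    · rw [div_le_one hK', hKdef, ← sum_fin_ite_half]
      refine Finset.sum_le_sum fun t _ => ?_
      simp only [ha]
      split_ifs
      · exact (hI _ _).2
      · exact le_rfl
  have hpred : ((tailPredictor Q x ⟨n, S⟩ : unitInterval) : ℝ) = (∑ t, a t) / K := by
    rw [← havg, tailPredictor, Set.projIcc_of_mem _ hmem]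
  have hy : (y : ℝ) = (∑ t : Fin n, if n / 2 ≤ (t : ℕ) then (y : ℝ) else 0) / K := by
    rw [eq_div_iff hK'.ne', hKdef, ← sum_fin_ite_half, Finset.mul_sum]
    simp
  simp only
  rw [hpred]
  nth_rewrite 1 [hy]
  rw [← sub_div, ← Finset.sum_sub_distrib, abs_div, abs_of_pos hK']
  refine div_le_div_of_nonneg_right ((Finset.abs_sum_le_sum_abs _ _).trans
    (Finset.sum_le_sum fun t _ => ?_)) hK'.le
  simp only [ha, l]
  split_ifs <;> simp

/-- Restricting to the later half gives d / (t + 1) ≤ 2d / n, whereas averaging over all t would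
cost a factor log n. At least n / 2 terms remain, so the bound is 16γ + 8d / n + (8 / n) log (1 /
δ). -/
lemma sum_tail_rate_le (γ : ℝ) (d : ℕ) {n : ℕ} (hn : 1 ≤ n) {δ : ℝ} (hδ : 0 < δ)
    (hδ1 : δ < 1) :
    (4 * ∑ t : Fin n, (if n / 2 ≤ (t : ℕ) then 4 * γ + d / ((t : ℕ) + 1) else 0) +
      4 * Real.log (1 / δ)) / (n - n / 2 : ℕ) ≤
      16 * (γ + d / n + 1 / n * Real.log (2 * Real.exp 1 / δ)) := by
  have hn' : (0 : ℝ) < n := by exact_mod_cast hn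
  have hK : (n : ℝ) / 2 ≤ (n - n / 2 : ℕ) := by
    have : n ≤ 2 * (n - n / 2) := by omega
    have : (n : ℝ) ≤ 2 * (n - n / 2 : ℕ) := by exact_mod_cast this
    linarith
  have hK' : (0 : ℝ) < (n - n / 2 : ℕ) := by linarith
  have hsum : ∑ t : Fin n, (if n / 2 ≤ (t : ℕ) then 4 * γ + d / ((t : ℕ) + 1) else (0 : ℝ)) ≤
      (n - n / 2 : ℕ) * (4 * γ + 2 * d / n) := by
    rw [← sum_fin_ite_half, Finset.sum_mul]
    refine Finset.sum_le_sum fun t _ => ?_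
    split_ifs with h
    · rw [one_mul]
      have h1 : n ≤ 2 * ((t : ℕ) + 1) := by omega
      have h2 : (n : ℝ) ≤ 2 * ((t : ℕ) + 1) := by exact_mod_cast h1
      have h3 : (d : ℝ) / ((t : ℕ) + 1) ≤ 2 * d / n := by
        rw [div_le_div_iff₀ (by positivity) hn']
        nlinarith [Nat.cast_nonneg (α := ℝ) d]
      linarith
    · simp
  have hlog0 : 0 ≤ Real.log (1 / δ) := Real.log_nonneg (by rw [le_div_iff₀ hδ]; linarith)
  have hlog : Real.log (1 / δ) ≤ Real.log (2 * Real.exp 1 / δ) := by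
    refine Real.log_le_log (by positivity) ?_
    gcongr
    have := Real.add_one_le_exp 1
    linarith
  have h1 : 4 * Real.log (1 / δ) / (n - n / 2 : ℕ) ≤ 8 * (1 / n * Real.log (1 / δ)) := by
    rw [div_le_iff₀ hK']
    have : 8 * (1 / n * Real.log (1 / δ)) * (n / 2) = 4 * Real.log (1 / δ) := by
      field_simp; ring
    rw [← this]
    gcongr
  have h2 : 4 * (∑ t : Fin n, (if n / 2 ≤ (t : ℕ) then 4 * γ + d / ((t : ℕ) + 1) else (0 : ℝ))) /
      (n - n / 2 : ℕ) ≤ 4 * (4 * γ + 2 * d / n) := by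
    rw [div_le_iff₀ hK']
    linarith
  have h3 : 1 / n * Real.log (1 / δ) ≤ 1 / n * Real.log (2 * Real.exp 1 / δ) := by gcongr
  have h4 : 0 ≤ 1 / n * Real.log (1 / δ) := by positivity
  have h5 : (0 : ℝ) ≤ d / n := by positivity
  have h6 : 2 * (d : ℝ) / n = 2 * (d / n) := by ring
  rw [add_div]
  linarith

end FinalPredictor

/-! ### The main theorem. -/

theorem theorem5 :
    ∃ C : ℝ, 0 < C ∧
      ∀ (X : Type*) [MeasurableSpace X] (H : Set (X → unitInterval)), IsMeasurableClass H →
      ∀ γ : ℝ, 0 < γ → γ < 1 → ∀ d : ℕ, vDim H γ = d →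
        ∃ f : Predictor X unitInterval, f.IsMeasurable ∧
          ∀ P : Measure (X × unitInterval), IsProbabilityMeasure P → IsRealizable H P →
          ∀ δ : ℝ, 0 < δ → δ < 1 → ∀ n : ℕ, 1 ≤ n →
            Measure.pi (fun _ : Fin n => P)
              {S | ¬ absRisk P (fun x => f x ⟨n, S⟩) ≤
                C * (γ + d / n + 1 / n * Real.log (2 * Real.exp 1 / δ))}
              ≤ ENNReal.ofReal δ := by
  refine ⟨16, by norm_num, fun X _ H hH γ hγ _ d hd => ?_⟩
  choose Q hQm hQI hQlab hQsymm hQloo using exists_symmetric_leaveOneOut_rule hH hγ hd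
  refine ⟨tailPredictor Q, isMeasurable_tailPredictor hQm, fun P hP hreal δ hδ hδ1 n hn => ?_⟩
  obtain ⟨f, hf, hfP⟩ := hreal
  -- Losses and rates are zeroed before n / 2, so that the concentration bound over all prefixes
  -- sees only the averaged rules.
  let l : ∀ t, (Fin (t + 1) → X × unitInterval) → ℝ := fun t z =>
    if n / 2 ≤ t then |Q t z - ((z (Fin.last t)).2 : ℝ)| else 0
  let c : ℕ → ℝ := fun t => if n / 2 ≤ t then 4 * γ + d / ((t : ℝ) + 1) else 0
  have hlm : ∀ t, UniversallyMeasurable (l t) := by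
    intro t μ hμ
    simp only [l]
    split_ifs
    · exact (continuous_abs.measurable.comp_aemeasurable
        ((hQm t μ hμ).sub (Measurable.aemeasurable (by fun_prop))))
    · exact aemeasurable_const
  have hlI : ∀ t z, l t z ∈ Set.Icc (0 : ℝ) 1 := by
    intro t z
    simp only [l]
    split_ifs
    · refine ⟨abs_nonneg _, abs_le.2 ⟨?_, ?_⟩⟩
      · linarith [(hQI t z).1, (z (Fin.last t)).2.2.2]
      · linarith [(hQI t z).2, (z (Fin.last t)).2.2.1]
    · simp
  have hlsymm : ∀ t (ρ : Equiv.Perm (Fin (t + 1))) z, ρ (Fin.last t) = Fin.last t →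
      l t (fun j => z (ρ j)) = l t z := by
    intro t ρ z hρ
    simp only [l, hQsymm t ρ z hρ, hρ]
  have hlloo : ∀ t, ∀ᵐ z ∂Measure.pi (fun _ : Fin (t + 1) => P),
      ∑ i, l t (fun j => z (Equiv.swap i (Fin.last t) j)) ≤ c t * (t + 1) := by
    intro t
    have hae : ∀ᵐ z ∂Measure.pi (fun _ : Fin (t + 1) => P), ∀ i, (z i).2 = f (z i).1 :=
      Filter.eventually_all.2 fun i =>
        (Measure.quasiMeasurePreserving_eval (fun _ : Fin (t + 1) => P) i).ae hfP
    filter_upwards [hae] with z hz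
    simp only [l, c]
    split_ifs
    · simp only [Equiv.swap_apply_right]
      refine (hQloo t f hf z hz).trans (le_of_eq ?_)
      field_simp
    · simp
  refine (measure_mono ?_).trans (measure_prefixSum_risk_le P hlm hlI hlsymm hlloo n hδ)
  intro S hS hle
  refine hS ((absRisk_tailPredictor_le hQm hQI hQlab P hn S).trans
    (le_trans ?_ (sum_tail_rate_le γ d hn hδ hδ1)))
  refine div_le_div_of_nonneg_right ?_ (Nat.cast_nonneg _)
  simpa only [l, Fin.snoc_last] using hle
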